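/- Let $N\ge 1$ and $m\ge 1$ be integers and let $\rho_2,\dots,\rho_N$ be real numbers with $|\rho_n|<1$. Let $x_{n,k},y_{n,k}$ ($1\le n\le N$, $1\le k\le m$) be jointly independent Gaussian random variables with mean $0$ and variance $1/2$. Put $g_{1,k}=x_{1,k}+\jmath y_{1,k}$ and, for $2\le n\le N$, $$g_{n,k}=\sqrt{1-\rho_n^2}\,x_{n,k}+\rho_n x_{1,k}+\jmath\left(\sqrt{1-\rho_n^2}\,y_{n,k}+\rho_n y_{1,k}\right),$$ where $\jmath=\sqrt{-1}$, and let $\hat h_n=\sum_{k=1}^m|g_{n,k}|^2$ for $1\le n\le N$ and $\hat h=\max\{\hat h_1,\dots,\hat h_N\}$. Write $\gamma(a,b)=\int_0^b e^{-t}t^{a-1}\,dt$ for the lower incomplete gamma function and $$S=1+\sum_{n=2}^N\frac{\rho_n^2}{1-\rho_n^2}.$$ Then for every $x\ge 0$ the cumulative distribution function of $\hat h$ is given by the convergent series $$F_{\hat h}(x)=\frac{1}{\Gamma(m)}\sum_{k=0}^\infty\frac{c_k}{S^{m+k}}\,\gamma(m+k,Sx),$$ where $$c_k=\sum_{\substack{l_2,\dots,l_N\ge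 0\\ l_2+\cdots+l_N=k}}\alpha_{2,l_2}\alpha_{3,l_3}\cdots\alpha_{N,l_N},\qquad \alpha_{n,l}=\left(\frac{\rho_n^2}{1-\rho_n^2}\right)^{l}\frac{\gamma\left(m+l,\frac{x}{1-\rho_n^2}\right)}{l!\,\Gamma(m+l)}$$ (with $0^0=1$; for $N=1$ this means $c_0=1$ and $c_k=0$ for $k>0$). If moreover $\rho_n=0$ for all $n$, then $S=1$, $c_k=0$ for all $k>0$, and $$F_{\hat h}(x)=\left(\frac{\gamma(m,x)}{\Gamma(m)}\right)^N.$$ -/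

import Mathlib

open MeasureTheory ProbabilityTheory

noncomputable section

namespace FluidAntenna

/-- The lower incomplete gamma function `γ(a, x) = ∫₀ˣ exp (-t) t ^ (a - 1) dt`. -/
def lowerGamma (a x : ℝ) : ℝ := ∫ t in (0 : ℝ)..x, Real.exp (-t) * t ^ (a - 1)

section Model

variable {Ω : Type*} {M m : ℕ}

/-- The complex Gaussian components `g n k` of the channels at the `N = M + 1` ports, with unit
`σ`. Port `0` is the reference port; the other ports are `n.succ` for `n : Fin M`, and `ρ n`
is the correlation parameter of the port `n.succ` with respect to the reference port. -/
def gain (ρ : Fin M → ℝ) (X Y : Fin (M + 1) → Fin m → Ω → ℝ)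
    (n : Fin (M + 1)) (k : Fin m) (ω : Ω) : ℂ :=
  Fin.cases (motive := fun _ => ℂ)
    ((X 0 k ω : ℂ) + Complex.I * (Y 0 k ω : ℂ))
    (fun j =>
      ((Real.sqrt (1 - ρ j ^ 2) * X j.succ k ω + ρ j * X 0 k ω : ℝ) : ℂ) +
        Complex.I * ((Real.sqrt (1 - ρ j ^ 2) * Y j.succ k ω + ρ j * Y 0 k ω : ℝ) : ℂ))
    n

/-- The channel power at port `n`: the sum of the squared magnitudes of its components. -/
def channel (ρ : Fin M → ℝ) (X Y : Fin (M + 1) → Fin m → Ω → ℝ)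
    (n : Fin (M + 1)) (ω : Ω) : ℝ :=
  ∑ k : Fin m, ‖gain ρ X Y n k ω‖ ^ 2

/-- The largest of the `M + 1` channel powers. -/
def maxChannel (ρ : Fin M → ℝ) (X Y : Fin (M + 1) → Fin m → Ω → ℝ) (ω : Ω) : ℝ :=
  Finset.univ.sup' Finset.univ_nonempty (fun n : Fin (M + 1) => channel ρ X Y n ω)

end Model

/-- `S = 1 + ∑ ρₙ² / (1 - ρₙ²)`, the sum being over the ports other than the reference port. -/
def S {M : ℕ} (ρ : Fin M → ℝ) : ℝ := 1 + ∑ n : Fin M, ρ n ^ 2 / (1 - ρ n ^ 2)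

/-- `α = (r² / (1 - r²)) ^ l * γ(m + l, x / (1 - r²)) / (l! Γ(m + l))`. -/
def alpha (m : ℕ) (r x : ℝ) (l : ℕ) : ℝ :=
  (r ^ 2 / (1 - r ^ 2)) ^ l *
    (lowerGamma (m + l) (x / (1 - r ^ 2)) / (l.factorial * Real.Gamma (m + l)))

/-- The sum of `∏ₙ α_{n, lₙ}` over all `l : Fin M → ℕ` with `∑ₙ lₙ = k`. -/
def coeff {M : ℕ} (m : ℕ) (ρ : Fin M → ℝ) (x : ℝ) (k : ℕ) : ℝ :=
  ∑ l ∈ Finset.piAntidiag (Finset.univ : Finset (Fin M)) k,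
    ∏ n : Fin M, alpha m (ρ n) x (l n)

end FluidAntenna

end

/-! Condition on the 2m Gaussian components `v` of the reference port and let `u = ∑ vᵢ²`. Given `v`
the other channel powers are independent, and the power at port `n`, divided by `1 - ρₙ²`, is a sum
of 2m squares of shifted Gaussians. Such a sum is a Poisson mixture of gamma laws of shapes `m + l`
(`map_sum_sq_pi_gaussianReal`), by comparison of characteristic functions. So the conditional
distribution function is `exp (-ρₙ² u / (1 - ρₙ²)) * ∑ α_{n,l} u ^ l` (`pi_gaussianReal_sum_sq_le`),
a function of `u` alone, and `u` has the gamma law of shape `m`.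

Multiplying over the ports, the exponentials merge with the gamma density into `exp (-S u)` and the
power series multiply to `∑ cₖ u ^ k`; integrating over `(0, x]` term by term gives the formula
(`lintegral_gammaMeasure_series`). Every term is nonnegative, so the computation runs in `ENNReal`,
where exchanging sum and integral is free; summability follows at the end because the total is a
probability. -/

noncomputable section

namespace FluidAntenna

/-! ### Characteristic functions of gamma laws -/

open Complex in
theorem one_sub_ofReal_mul_I_ne_zero (t : ℝ) : (1 - t * I : ℂ) ≠ 0 := by
  intro h
  simpa using congrArg re h

theorem integrableOn_pow_mul_exp_neg (n : ℕ) :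
    IntegrableOn (fun u : ℝ => u ^ n * Real.exp (-u)) (Set.Ioi 0) := by
  have h := Real.GammaIntegral_convergent (s := n + 1) (by positivity)
  simpa [mul_comm] using h

open Complex in
theorem norm_pow_mul_cexp_neg (n : ℕ) (t : ℝ) {u : ℝ} (hu : 0 ≤ u) :
    ‖(u : ℂ) ^ n * cexp (-((1 - t * I) * u))‖ = u ^ n * Real.exp (-u) := by
  simp [Complex.norm_exp, abs_of_nonneg hu]

open Complex in
theorem integrableOn_pow_mul_cexp_neg (n : ℕ) (t : ℝ) :
    IntegrableOn (fun u : ℝ => (u : ℂ) ^ n * cexp (-((1 - t * I) * u))) (Set.Ioi 0) := by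
  refine (integrableOn_pow_mul_exp_neg n).mono' (by fun_prop) ?_
  filter_upwards [ae_restrict_mem measurableSet_Ioi] with u hu
  exact (norm_pow_mul_cexp_neg n t (le_of_lt hu)).le

-- Induction on `n` by parts; the boundary terms vanish at 0 because of the power and at infinity
-- because of `exp (-u)`.
open Complex Filter Topology in
theorem integral_pow_mul_cexp_neg (n : ℕ) (t : ℝ) :
    ∫ u in Set.Ioi (0 : ℝ), (u : ℂ) ^ n * cexp (-((1 - t * I) * u)) =
      n.factorial * (1 / (1 - t * I)) ^ (n + 1) := by
  have hr := one_sub_ofReal_mul_I_ne_zero t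
  induction n with
  | zero =>
    have h := integral_exp_mul_complex_Ioi (a := -(1 - t * I)) (by simp) 0
    simp only [neg_mul] at h
    simp [h, neg_div_neg_eq, -neg_sub]
  | succ n ih =>
    have hd : ∀ u ∈ Set.Ioi (0 : ℝ), HasDerivAt (fun u : ℝ => (u : ℂ) ^ (n + 1))
        ((n + 1 : ℂ) * (u : ℂ) ^ n) u := fun u _ => by
      simpa using (hasDerivAt_pow (n + 1) (u : ℂ)).comp_ofReal
    have he : ∀ u ∈ Set.Ioi (0 : ℝ), HasDerivAt
        (fun u : ℝ => -(1 / (1 - t * I)) * cexp (-((1 - t * I) * u)))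
        (cexp (-((1 - t * I) * u))) u := fun u _ => by
      have h1 : HasDerivAt (fun u : ℝ => -((1 - t * I) * (u : ℂ))) (-((1 - t * I) * 1)) u :=
        ((Complex.ofRealCLM.hasDerivAt (x := u)).const_mul _).neg
      refine (h1.cexp.const_mul (-(1 / (1 - t * I)))).congr_deriv ?_
      field_simp
    have key := integral_Ioi_mul_deriv_eq_deriv_mul (a := 0) (a' := 0) (b' := 0) hd he
      (integrableOn_pow_mul_cexp_neg (n + 1) t)
      (by
        refine IntegrableOn.congr_fun ((integrableOn_pow_mul_cexp_neg n t).const_mul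
          ((n + 1) * -(1 / (1 - t * I)))) (fun u _ => ?_) measurableSet_Ioi
        simp only [Pi.mul_apply]
        ring)
      (by
        have : ContinuousAt ((fun u : ℝ => (u : ℂ) ^ (n + 1)) *
          fun u : ℝ => -(1 / (1 - t * I)) * cexp (-((1 - t * I) * u))) 0 := by fun_prop
        simpa using this.tendsto.mono_left nhdsWithin_le_nhds)
      (by
        have h0 := (Real.tendsto_pow_mul_exp_neg_atTop_nhds_zero (n + 1)).const_mul
          ‖-(1 / (1 - t * I))‖
        rw [mul_zero] at h0
        refine tendsto_zero_iff_norm_tendsto_zero.2 (h0.congr' ?_)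
        filter_upwards [eventually_ge_atTop 0] with u hu
        rw [← norm_pow_mul_cexp_neg (n + 1) t hu, ← norm_mul, Pi.mul_apply]
        congr 1
        ring)
    rw [key]
    have : ∀ u : ℝ, (n + 1 : ℂ) * (u : ℂ) ^ n *
        (-(1 / (1 - t * I)) * cexp (-((1 - t * I) * u))) =
        ((n + 1) * -(1 / (1 - t * I))) * ((u : ℂ) ^ n * cexp (-((1 - t * I) * u))) :=
      fun u => by ring
    simp_rw [this, integral_const_mul, ih, Nat.factorial_succ]
    push_cast
    ring

open Complex in
theorem charFun_gammaMeasure_natCast (n : ℕ) (hn : 1 ≤ n) (t : ℝ) :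
    charFun (gammaMeasure n 1) t = (1 / (1 - t * I)) ^ n := by
  obtain ⟨n, rfl⟩ := Nat.exists_eq_add_of_le' hn
  have hG : ((n.factorial : ℝ) : ℂ) ≠ 0 := by exact_mod_cast n.factorial_ne_zero
  rw [charFun_apply_real, gammaMeasure, integral_withDensity_eq_integral_toReal_smul
    (by unfold gammaPDF; fun_prop) (by simp [gammaPDF])]
  rw [← setIntegral_eq_integral_of_forall_compl_eq_zero (s := Set.Ici 0)
    (fun u hu => by simp [gammaPDF_of_neg (not_le.1 hu)]), integral_Ici_eq_integral_Ioi]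
  have : ∀ u ∈ Set.Ioi (0 : ℝ), (gammaPDF ((n + 1 : ℕ) : ℝ) 1 u).toReal • cexp (t * u * I) =
      ((n.factorial : ℝ) : ℂ)⁻¹ * ((u : ℂ) ^ n * cexp (-((1 - t * I) * u))) := fun u hu => by
    have hu : 0 < u := hu
    have h1 : (((n + 1 : ℕ) : ℝ) - 1) = n := by push_cast; ring
    rw [gammaPDF_of_nonneg hu.le, ENNReal.toReal_ofReal (by positivity), h1, Real.rpow_natCast]
    push_cast
    rw [Real.Gamma_nat_eq_factorial, Complex.real_smul,
      show (-((1 - t * I) * u) : ℂ) = ((-u : ℝ) : ℂ) + t * u * I by push_cast; ring,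
      Complex.exp_add]
    simp
    ring_nf
  rw [setIntegral_congr_fun measurableSet_Ioi this, integral_const_mul,
    integral_pow_mul_cexp_neg, ← mul_assoc]
  push_cast at hG ⊢
  rw [inv_mul_cancel₀ hG, one_mul]

/-! ### Sums of squares of shifted Gaussians -/

open Complex in
theorem ofReal_mul_cpow_half {a : ℝ} (ha : 0 < a) {z : ℂ} (hz : z ≠ 0) :
    (a * z : ℂ) ^ (1 / 2 : ℂ) = √a * z ^ (1 / 2 : ℂ) := by
  have ha' : (a : ℂ) ≠ 0 := by exact_mod_cast ha.ne'
  -- The principal logarithm splits off a positive real factor without a change of branch.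
  rw [cpow_def_of_ne_zero (mul_ne_zero ha' hz), log_ofReal_mul ha hz, add_mul, Complex.exp_add,
    ← cpow_def_of_ne_zero hz, ofReal_log ha.le, ← cpow_def_of_ne_zero ha', Real.sqrt_eq_rpow,
    ofReal_cpow ha.le]
  simp

-- With variance 1/2 the density is `exp (-z²) / √π`, so this is a complex Gaussian integral with
-- quadratic coefficient `-(1 - t * I)`.
open Complex in
theorem integral_cexp_sq_gaussianReal (a t : ℝ) :
    ∫ z, cexp (t * ((z + a) ^ 2 : ℝ) * I) ∂(gaussianReal 0 (1 / 2)) =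
      (1 / (1 - t * I)) ^ (1 / 2 : ℂ) * cexp ((a ^ 2 : ℝ) * (t * I / (1 - t * I))) := by
  have hr := one_sub_ofReal_mul_I_ne_zero t
  rw [integral_gaussianReal_eq_integral_smul (by norm_num)]
  have h := integral_cexp_quadratic (b := -(1 - t * I)) (by simp) (2 * a * t * I) (a ^ 2 * t * I)
  have : ∀ z : ℝ, gaussianPDFReal 0 (1 / 2) z • cexp (t * ((z + a) ^ 2 : ℝ) * I) =
      ((√Real.pi)⁻¹ : ℝ) * cexp (-(1 - t * I) * z ^ 2 + 2 * a * t * I * z + a ^ 2 * t * I) :=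
    fun z => by
      have hv : (2 * Real.pi * ((1 / 2 : NNReal) : ℝ)) = Real.pi := by push_cast; ring
      rw [gaussianPDFReal, Complex.real_smul, hv, Complex.ofReal_mul, mul_assoc,
        Complex.ofReal_exp, ← Complex.exp_add]
      congr 2
      push_cast
      ring
  simp_rw [this, integral_const_mul, h, neg_neg, ← mul_assoc]
  congr 1
  · have hπ : (√Real.pi : ℂ) ≠ 0 := by
      exact_mod_cast (Real.sqrt_pos.2 Real.pi_pos).ne'
    rw [div_eq_mul_one_div, ofReal_mul_cpow_half Real.pi_pos (one_div_ne_zero hr),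
      Complex.ofReal_inv, inv_mul_cancel_left₀ hπ]
  · congr 1
    push_cast
    field_simp
    ring_nf

/-- The law of a noncentral chi-square type variable: the mixture of the gamma distributions with
shapes `m + l` and rate `1`, weighted by the Poisson distribution of parameter `c`. -/
def noncentralGamma (m : ℕ) (c : ℝ) : Measure ℝ :=
  Measure.sum fun l : ℕ =>
    ENNReal.ofReal (Real.exp (-c) * c ^ l / l.factorial) • gammaMeasure ((m + l : ℕ) : ℝ) 1

theorem hasSum_poisson_weights (c : ℝ) :
    HasSum (fun l : ℕ => Real.exp (-c) * c ^ l / l.factorial) 1 := by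
  convert! (NormedSpace.expSeries_div_hasSum_exp c).mul_left (Real.exp (-c)) using 1
  · simp_rw [mul_div_assoc]
  · simp [← Real.exp_eq_exp_ℝ, ← Real.exp_add]

theorem isProbabilityMeasure_noncentralGamma {m : ℕ} (hm : 1 ≤ m) {c : ℝ} (hc : 0 ≤ c) :
    IsProbabilityMeasure (noncentralGamma m c) where
  measure_univ := by
    have h : ∀ l : ℕ, gammaMeasure ((m + l : ℕ) : ℝ) 1 Set.univ = 1 := fun l => by
      have := isProbabilityMeasure_gammaMeasure (a := ((m + l : ℕ) : ℝ)) (r := 1)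
        (by exact_mod_cast (by omega)) one_pos
      exact measure_univ
    rw [noncentralGamma, Measure.sum_apply _ MeasurableSet.univ]
    simp only [Measure.smul_apply, h, smul_eq_mul, mul_one]
    rw [← ENNReal.ofReal_tsum_of_nonneg (fun l => by positivity) (hasSum_poisson_weights c).summable,
      (hasSum_poisson_weights c).tsum_eq, ENNReal.ofReal_one]

open Complex in
theorem charFun_noncentralGamma {m : ℕ} (hm : 1 ≤ m) {c : ℝ} (hc : 0 ≤ c) (t : ℝ) :
    charFun (noncentralGamma m c) t =
      (1 / (1 - t * I)) ^ m * cexp (c * (t * I / (1 - t * I))) := by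
  have hr := one_sub_ofReal_mul_I_ne_zero t
  have := isProbabilityMeasure_noncentralGamma hm hc
  have hint : Integrable (fun u : ℝ => cexp (t * u * I)) (noncentralGamma m c) := by
    refine Integrable.of_bound (by fun_prop) 1 (ae_of_all _ fun u => ?_)
    rw [← ofReal_mul, norm_exp_ofReal_mul_I]
  rw [charFun_apply_real]
  refine (hasSum_integral_measure hint).unique ?_
  -- The mixture sums to an exponential series in `c / (1 - t * I)`; the Poisson factor `exp (-c)`
  -- then turns `1 / (1 - t * I)` into `1 / (1 - t * I) - 1 = t * I / (1 - t * I)`.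
  have h := (NormedSpace.expSeries_div_hasSum_exp ((c : ℂ) * (1 / (1 - t * I)))).mul_left
    (cexp (-c) * (1 / (1 - t * I)) ^ m)
  convert! h using 1
  · ext l
    rw [integral_smul_measure, ← charFun_apply_real, charFun_gammaMeasure_natCast _ (by omega),
      ENNReal.toReal_ofReal (by positivity), real_smul]
    push_cast
    ring
  · rw [← Complex.exp_eq_exp_ℂ, mul_right_comm, ← Complex.exp_add, mul_comm]
    congr 2
    field_simp
    ring

open Complex in
/-- The law of `∑ i, (Z i + a i) ^ 2` for independent centred Gaussian variables `Z i` of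
variance `1 / 2`. -/
theorem map_sum_sq_pi_gaussianReal {ι : Type*} [Fintype ι] {m : ℕ} (hm : 1 ≤ m)
    (hι : Fintype.card ι = 2 * m) (a : ι → ℝ) :
    (Measure.pi fun _ : ι => gaussianReal 0 (1 / 2)).map (fun z => ∑ i, (z i + a i) ^ 2) =
      noncentralGamma m (∑ i, a i ^ 2) := by
  have hc : 0 ≤ ∑ i, a i ^ 2 := by positivity
  have := isProbabilityMeasure_noncentralGamma hm hc
  have hmeas : Measurable fun z : ι → ℝ => ∑ i, (z i + a i) ^ 2 := by fun_prop
  have := Measure.isProbabilityMeasure_map (μ := Measure.pi fun _ : ι => gaussianReal 0 (1 / 2))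
    hmeas.aemeasurable
  refine Measure.ext_of_charFun (funext fun t => ?_)
  rw [charFun_noncentralGamma hm hc, charFun_apply_real,
    integral_map hmeas.aemeasurable (by fun_prop)]
  have : ∀ z : ι → ℝ, cexp (t * ((∑ i, (z i + a i) ^ 2 : ℝ) : ℂ) * I) =
      ∏ i, cexp (t * (((z i + a i) ^ 2 : ℝ) : ℂ) * I) := fun z => by
    rw [← Complex.exp_sum, ofReal_sum, Finset.mul_sum, Finset.sum_mul]
  simp_rw [this]
  rw [integral_fintype_prod_eq_prod (fun i (z : ℝ) => cexp (t * (((z + a i) ^ 2 : ℝ) : ℂ) * I))]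
  simp_rw [integral_cexp_sq_gaussianReal, Finset.prod_mul_distrib, Finset.prod_const,
    Finset.card_univ, hι, pow_mul, ← Complex.exp_sum, ← Finset.sum_mul]
  -- The even number of factors squares the principal root away, leaving an integer power.
  rw [← cpow_nat_mul]
  simp

/-! ### Conditional distribution function at a port -/

theorem gammaMeasure_Iic (n : ℕ) (hn : 1 ≤ n) {x : ℝ} (hx : 0 ≤ x) :
    gammaMeasure n 1 (Set.Iic x) = ENNReal.ofReal (lowerGamma n x / Real.Gamma n) := by
  have hn' : (0 : ℝ) < n := by exact_mod_cast hn
  have := isProbabilityMeasure_gammaMeasure hn' one_pos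
  have hG : 0 < Real.Gamma n := Real.Gamma_pos_of_pos hn'
  rw [← ofReal_measureReal, ← cdf_eq_real, cdf_gammaMeasure_eq_integral hn' one_pos]
  congr 1
  rw [setIntegral_eq_of_subset_of_forall_sdiff_eq_zero measurableSet_Iic
    (s := Set.Icc 0 x) Set.Icc_subset_Iic_self, integral_Icc_eq_integral_Ioc,
    ← intervalIntegral.integral_of_le hx, lowerGamma, div_eq_inv_mul,
    ← intervalIntegral.integral_const_mul]
  · refine intervalIntegral.integral_congr fun u hu => ?_
    rw [Set.uIcc_of_le hx] at hu
    simp only [gammaPDFReal, hu.1, if_true]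
    simp
    ring
  · intro u hu
    have : ¬ 0 ≤ u := fun h => hu.2 ⟨h, hu.1⟩
    simp [gammaPDFReal, this]

theorem lowerGamma_nonneg (a : ℝ) {x : ℝ} (hx : 0 ≤ x) : 0 ≤ lowerGamma a x :=
  intervalIntegral.integral_nonneg hx fun u hu => by
    have := Real.rpow_nonneg hu.1 (a - 1)
    positivity

theorem one_sub_sq_pos {r : ℝ} (hr : |r| < 1) : 0 < 1 - r ^ 2 := by
  have := (sq_lt_one_iff_abs_lt_one r).2 hr
  linarith

theorem alpha_nonneg {m : ℕ} (hm : 1 ≤ m) {r x : ℝ} (hr : |r| < 1) (hx : 0 ≤ x) (l : ℕ) :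
    0 ≤ alpha m r x l := by
  have h := one_sub_sq_pos hr
  have hG : 0 < Real.Gamma (m + l) := Real.Gamma_pos_of_pos (by positivity)
  have := lowerGamma_nonneg (m + l) (div_nonneg hx h.le)
  unfold alpha
  positivity

/-- The conditional distribution function of a channel power at a non-reference port, given the
components `v` at the reference port. -/
theorem pi_gaussianReal_sum_sq_le {ι : Type*} [Fintype ι] {m : ℕ} (hm : 1 ≤ m)
    (hι : Fintype.card ι = 2 * m) {r x : ℝ} (hr : |r| < 1) (hx : 0 ≤ x) (v : ι → ℝ) :
    (Measure.pi fun _ : ι => gaussianReal 0 (1 / 2))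
        {z | ∑ i, (√(1 - r ^ 2) * z i + r * v i) ^ 2 ≤ x} =
      ENNReal.ofReal (Real.exp (-(r ^ 2 / (1 - r ^ 2) * ∑ i, v i ^ 2))) *
        ∑' l : ℕ, ENNReal.ofReal (alpha m r x l * (∑ i, v i ^ 2) ^ l) := by
  have h := one_sub_sq_pos hr
  have hs : √(1 - r ^ 2) ≠ 0 := (Real.sqrt_pos.2 h).ne'
  have hsq := Real.sq_sqrt h.le
  set u := ∑ i, v i ^ 2 with hu
  have hu0 : 0 ≤ u := by positivity
  have hset : {z : ι → ℝ | ∑ i, (√(1 - r ^ 2) * z i + r * v i) ^ 2 ≤ x} =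
      (fun z : ι → ℝ => ∑ i, (z i + r * v i / √(1 - r ^ 2)) ^ 2) ⁻¹'
        Set.Iic (x / (1 - r ^ 2)) := by
    ext z
    simp only [Set.mem_ofPred_eq, Set.mem_preimage, Set.mem_Iic]
    rw [le_div_iff₀ h, Finset.sum_mul]
    have : ∀ i, (z i + r * v i / √(1 - r ^ 2)) ^ 2 * (1 - r ^ 2) =
        (√(1 - r ^ 2) * z i + r * v i) ^ 2 := fun i => by
      nth_rewrite 2 [← hsq]
      rw [← mul_pow]
      congr 1
      field_simp
    simp_rw [this]
  have hpar : ∑ i, (r * v i / √(1 - r ^ 2)) ^ 2 = r ^ 2 / (1 - r ^ 2) * u := by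
    rw [hu, Finset.mul_sum]
    refine Finset.sum_congr rfl fun i _ => ?_
    rw [div_pow, hsq]
    ring
  rw [hset, ← Measure.map_apply (by fun_prop) measurableSet_Iic,
    map_sum_sq_pi_gaussianReal hm hι, hpar, noncentralGamma, Measure.sum_apply _ measurableSet_Iic,
    ← ENNReal.tsum_mul_left]
  refine tsum_congr fun l => ?_
  rw [Measure.smul_apply, gammaMeasure_Iic _ (by omega) (div_nonneg hx h.le), smul_eq_mul,
    ← ENNReal.ofReal_mul (by positivity), ← ENNReal.ofReal_mul (by positivity), alpha, mul_pow]
  push_cast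
  congr 1
  field_simp

/-! ### Products of nonnegative power series -/

theorem ennreal_tsum_mul_tsum_eq_tsum_sum_antidiagonal (f g : ℕ → ENNReal) :
    (∑' a, f a) * ∑' b, g b = ∑' n, ∑ p ∈ Finset.HasAntidiagonal.antidiagonal n, f p.1 * g p.2 := by
  simp_rw [← ENNReal.tsum_mul_right, ← ENNReal.tsum_mul_left]
  rw [← ENNReal.tsum_prod, ← Finset.HasAntidiagonal.sigmaAntidiagonalEquivProd.tsum_eq, ENNReal.tsum_sigma']
  refine tsum_congr fun n => ?_
  rw [tsum_fintype]
  exact Finset.sum_coe_sort _ fun p : ℕ × ℕ => f p.1 * g p.2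

theorem ennreal_prod_tsum {ι : Type*} [DecidableEq ι] (s : Finset ι) (f : ι → ℕ → ENNReal) :
    ∏ i ∈ s, ∑' l, f i l = ∑' k, ∑ l ∈ s.piAntidiag k, ∏ i ∈ s, f i (l i) := by
  induction s using Finset.cons_induction with
  | empty =>
    rw [tsum_eq_single 0]
    · simp
    · intro k hk
      simp [Finset.piAntidiag_empty_of_ne_zero hk]
  | cons i s hi ih =>
    rw [Finset.prod_cons, ih, ennreal_tsum_mul_tsum_eq_tsum_sum_antidiagonal]
    refine tsum_congr fun n => ?_
    rw [Finset.piAntidiag_cons, Finset.sum_disjiUnion]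
    refine Finset.sum_congr rfl fun p _ => ?_
    rw [Finset.sum_map, Finset.mul_sum]
    refine Finset.sum_congr rfl fun l hl => ?_
    rw [Finset.mem_piAntidiag] at hl
    -- Members of `s.piAntidiag` vanish off `s`, so the value at the new index `i` is exactly the
    -- first part of the antidiagonal pair.
    have hli : l i = 0 := by
      by_contra h
      exact hi (hl.2 i h)
    rw [Finset.prod_cons]
    congr 1
    · simp [hli]
    · refine Finset.prod_congr rfl fun j hj => ?_
      have : j ≠ i := fun h => hi (h ▸ hj)
      simp [this]

theorem coeff_nonneg {M m : ℕ} (hm : 1 ≤ m) {ρ : Fin M → ℝ} (hρ : ∀ n, |ρ n| < 1) {x : ℝ}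
    (hx : 0 ≤ x) (k : ℕ) : 0 ≤ coeff m ρ x k :=
  Finset.sum_nonneg fun _ _ => Finset.prod_nonneg fun n _ => alpha_nonneg hm (hρ n) hx _

theorem prod_tsum_alpha {M m : ℕ} (hm : 1 ≤ m) {ρ : Fin M → ℝ} (hρ : ∀ n, |ρ n| < 1) {x u : ℝ}
    (hx : 0 ≤ x) (hu : 0 ≤ u) :
    ∏ n, ∑' l : ℕ, ENNReal.ofReal (alpha m (ρ n) x l * u ^ l) =
      ∑' k : ℕ, ENNReal.ofReal (coeff m ρ x k * u ^ k) := by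
  have hα := fun n => alpha_nonneg hm (hρ n) hx
  rw [ennreal_prod_tsum]
  refine tsum_congr fun k => ?_
  rw [coeff, Finset.sum_mul, ENNReal.ofReal_sum_of_nonneg fun l _ =>
    mul_nonneg (Finset.prod_nonneg fun n _ => hα n _) (by positivity)]
  refine Finset.sum_congr rfl fun l hl => ?_
  rw [← ENNReal.ofReal_prod_of_nonneg fun n _ => mul_nonneg (hα n _) (by positivity),
    Finset.prod_mul_distrib, Finset.prod_pow_eq_pow_sum, (Finset.mem_piAntidiag.1 hl).1]

theorem S_pos {M : ℕ} {ρ : Fin M → ℝ} (hρ : ∀ n, |ρ n| < 1) : 0 < S ρ := by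
  have : 0 ≤ ∑ n, ρ n ^ 2 / (1 - ρ n ^ 2) :=
    Finset.sum_nonneg fun n _ => div_nonneg (sq_nonneg _) (one_sub_sq_pos (hρ n)).le
  unfold S
  linarith

/-! ### Integration over the reference power -/

theorem setLIntegral_pow_mul_exp_neg {n : ℕ} {s x : ℝ} (hs : 0 < s) (hx : 0 ≤ x) :
    ∫⁻ u in Set.Ioc 0 x, ENNReal.ofReal (u ^ n * Real.exp (-(s * u))) =
      ENNReal.ofReal (lowerGamma ((n + 1 : ℕ) : ℝ) (s * x) / s ^ (n + 1)) := by
  rw [← ofReal_integral_eq_lintegral_ofReal, ← intervalIntegral.integral_of_le hx]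
  · congr 1
    have h := intervalIntegral.mul_integral_comp_mul_left (a := 0) (b := x)
      (f := fun t => Real.exp (-t) * t ^ n) s
    have hl : lowerGamma ((n + 1 : ℕ) : ℝ) (s * x) =
        ∫ t in (0 : ℝ)..(s * x), Real.exp (-t) * t ^ n := by
      simp [lowerGamma]
    rw [mul_zero] at h
    rw [hl, ← h, eq_div_iff (by positivity), ← intervalIntegral.integral_const_mul,
      ← intervalIntegral.integral_mul_const]
    refine intervalIntegral.integral_congr fun u _ => ?_
    simp only [mul_pow, pow_succ]
    ring
  · exact (Continuous.integrableOn_Icc (by fun_prop)).mono_set Set.Ioc_subset_Icc_self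
  · filter_upwards [ae_restrict_mem measurableSet_Ioc] with u hu
    have := hu.1.le
    simp only [Pi.zero_apply]
    positivity

theorem lintegral_gammaMeasure_series {M m : ℕ} (hm : 1 ≤ m) {ρ : Fin M → ℝ}
    (hρ : ∀ n, |ρ n| < 1) {x : ℝ} (hx : 0 ≤ x) :
    ∫⁻ u in Set.Iic x, ∏ n, (ENNReal.ofReal (Real.exp (-(ρ n ^ 2 / (1 - ρ n ^ 2) * u))) *
        ∑' l : ℕ, ENNReal.ofReal (alpha m (ρ n) x l * u ^ l)) ∂gammaMeasure m 1 =
      ∑' k : ℕ, ENNReal.ofReal (1 / Real.Gamma m *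
        (coeff m ρ x k / S ρ ^ (m + k) * lowerGamma (m + k) (S ρ * x))) := by
  have hS := S_pos hρ
  have hc := coeff_nonneg hm hρ hx
  have hm' : (0 : ℝ) < m := by exact_mod_cast hm
  have hG : 0 < Real.Gamma m := Real.Gamma_pos_of_pos hm'
  -- The density vanishes on the negatives, and the point 0 is null, so only `(0, x]` contributes.
  rw [gammaMeasure, setLIntegral_withDensity_eq_setLIntegral_mul _
    (by unfold gammaPDF; fun_prop) (by fun_prop) measurableSet_Iic,
    ← Set.Iic_union_Ioc_eq_Iic hx, lintegral_union measurableSet_Ioc (Set.Iic_disjoint_Ioc le_rfl),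
    ← setLIntegral_congr Iio_ae_eq_Iic,
    setLIntegral_congr_fun (g := fun _ => 0) measurableSet_Iio
      (fun u hu => by simp [gammaPDF_of_neg hu])]
  rw [lintegral_zero, zero_add, setLIntegral_congr_fun
    (g := fun u => ∑' k : ℕ, ENNReal.ofReal (coeff m ρ x k / Real.Gamma m) *
      ENNReal.ofReal (u ^ (m + k - 1) * Real.exp (-(S ρ * u)))) measurableSet_Ioc]
  · rw [lintegral_tsum (fun k => by fun_prop)]
    refine tsum_congr fun k => ?_
    rw [lintegral_const_mul _ (by fun_prop), setLIntegral_pow_mul_exp_neg hS hx,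
      ← ENNReal.ofReal_mul (div_nonneg (hc k) hG.le), Nat.sub_add_cancel (by omega)]
    push_cast
    congr 1
    ring
  · intro u hu
    have hu0 : 0 < u := hu.1
    simp only [Pi.mul_apply]
    rw [Finset.prod_mul_distrib, prod_tsum_alpha hm hρ hx hu0.le,
      ← ENNReal.ofReal_prod_of_nonneg fun n _ => (Real.exp_pos _).le, ← Real.exp_sum,
      gammaPDF_of_nonneg hu0.le, ← mul_assoc, ← ENNReal.ofReal_mul (by positivity),
      ← ENNReal.tsum_mul_left]
    refine tsum_congr fun k => ?_
    rw [← ENNReal.ofReal_mul (by positivity), ← ENNReal.ofReal_mul (div_nonneg (hc k) hG.le)]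
    congr 1
    have h1 : (m : ℝ) - 1 = ((m - 1 : ℕ) : ℝ) := by rw [Nat.cast_sub hm]; simp
    -- The summand 1 in `S` is the rate of the gamma density; the others are the Poisson factors of
    -- the ports.
    have h2 : -(S ρ * u) = -u + ∑ n, -(ρ n ^ 2 / (1 - ρ n ^ 2) * u) := by
      rw [S, Finset.sum_neg_distrib, ← Finset.sum_mul]
      ring
    rw [h1, Real.rpow_natCast u, h2, Real.exp_add, show m + k - 1 = (m - 1) + k by omega, pow_add,
      Real.one_rpow, one_mul]
    ring

theorem norm_add_I_mul_sq (a b : ℝ) : ‖(a : ℂ) + Complex.I * (b : ℂ)‖ ^ 2 = a ^ 2 + b ^ 2 := by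
  rw [mul_comm, Complex.sq_norm, Complex.normSq_add_mul_I]

/-! ### Law of the maximum in the channel model -/

section Model

variable {M m : ℕ}

theorem channel_zero {Ω : Type*} (ρ : Fin M → ℝ) (X Y : Fin (M + 1) → Fin m → Ω → ℝ) (ω : Ω) :
    channel ρ X Y 0 ω = ∑ k, X 0 k ω ^ 2 + ∑ k, Y 0 k ω ^ 2 := by
  simp only [channel, gain, Fin.cases_zero, norm_add_I_mul_sq, Finset.sum_add_distrib]

theorem channel_succ {Ω : Type*} (ρ : Fin M → ℝ) (X Y : Fin (M + 1) → Fin m → Ω → ℝ) (ω : Ω)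
    (n : Fin M) :
    channel ρ X Y n.succ ω =
      ∑ k, (√(1 - ρ n ^ 2) * X n.succ k ω + ρ n * X 0 k ω) ^ 2 +
        ∑ k, (√(1 - ρ n ^ 2) * Y n.succ k ω + ρ n * Y 0 k ω) ^ 2 := by
  simp only [channel, gain, Fin.cases_succ, norm_add_I_mul_sq, Finset.sum_add_distrib]

theorem maxChannel_le_iff {Ω : Type*} (ρ : Fin M → ℝ) (X Y : Fin (M + 1) → Fin m → Ω → ℝ) (ω : Ω)
    (x : ℝ) : maxChannel ρ X Y ω ≤ x ↔
      channel ρ X Y 0 ω ≤ x ∧ ∀ n : Fin M, channel ρ X Y n.succ ω ≤ x := by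
  simp [maxChannel, Finset.sup'_le_iff, Fin.forall_fin_succ]

/-- The law of the maximum under the product Gaussian measure, port `n` having the real components
`z n (Sum.inl k)` and the imaginary components `z n (Sum.inr k)`. -/
theorem pi_gaussianReal_maxChannel_le (hm : 1 ≤ m) {ρ : Fin M → ℝ} (hρ : ∀ n, |ρ n| < 1) {x : ℝ}
    (hx : 0 ≤ x) :
    (Measure.pi fun _ : Fin (M + 1) => Measure.pi fun _ : Fin m ⊕ Fin m => gaussianReal 0 (1 / 2))
        {z | maxChannel ρ (fun n k z => z n (Sum.inl k)) (fun n k z => z n (Sum.inr k)) z ≤ x} =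
      ∑' k : ℕ, ENNReal.ofReal (1 / Real.Gamma m *
        (coeff m ρ x k / S ρ ^ (m + k) * lowerGamma (m + k) (S ρ * x))) := by
  have hcard : Fintype.card (Fin m ⊕ Fin m) = 2 * m := by simp [two_mul]
  set γ := Measure.pi fun _ : Fin m ⊕ Fin m => gaussianReal 0 (1 / 2) with hγ
  set A : Set ((Fin m ⊕ Fin m → ℝ) × (Fin M → Fin m ⊕ Fin m → ℝ)) :=
    {p | ∑ i, p.1 i ^ 2 ≤ x ∧
      ∀ n, ∑ i, (√(1 - ρ n ^ 2) * p.2 n i + ρ n * p.1 i) ^ 2 ≤ x} with hA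
  have hAm : MeasurableSet A := by
    simp only [hA, Set.ofPred_and, Set.ofPred_forall]
    exact (measurableSet_le (by fun_prop) measurable_const).inter
      (MeasurableSet.iInter fun n => measurableSet_le (by fun_prop) measurable_const)
  have hmp := measurePreserving_piFinSuccAbove (fun _ : Fin (M + 1) => γ) 0
  have hset : {z : Fin (M + 1) → Fin m ⊕ Fin m → ℝ | maxChannel ρ
      (fun n k z => z n (Sum.inl k)) (fun n k z => z n (Sum.inr k)) z ≤ x} =
      MeasurableEquiv.piFinSuccAbove (fun _ => Fin m ⊕ Fin m → ℝ) 0 ⁻¹' A := by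
    ext z
    simp [maxChannel_le_iff, channel_zero, channel_succ, hA, MeasurableEquiv.piFinSuccAbove,
      Fin.tail]
  have hsec : ∀ v, (Measure.pi fun _ : Fin M => γ) (Prod.mk v ⁻¹' A) =
      (Set.Iic x).indicator (fun u => ∏ n,
        (ENNReal.ofReal (Real.exp (-(ρ n ^ 2 / (1 - ρ n ^ 2) * u))) *
          ∑' l : ℕ, ENNReal.ofReal (alpha m (ρ n) x l * u ^ l))) (∑ i, v i ^ 2) := fun v => by
    by_cases hv : ∑ i, v i ^ 2 ≤ x
    · have : Prod.mk v ⁻¹' A = Set.univ.pi fun n =>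
          {z | ∑ i, (√(1 - ρ n ^ 2) * z i + ρ n * v i) ^ 2 ≤ x} := by
        ext w
        simp only [hA, Set.mem_preimage, Set.mem_ofPred_eq, hv, true_and, Set.mem_univ_pi]
      rw [this, Measure.pi_pi, Set.indicator_of_mem (Set.mem_Iic.2 hv)]
      exact Finset.prod_congr rfl fun n _ => pi_gaussianReal_sum_sq_le hm hcard (hρ n) hx v
    · have : Prod.mk v ⁻¹' A = ∅ := by
        ext w
        simp only [hA, Set.mem_preimage, Set.mem_ofPred_eq, hv, false_and, Set.mem_empty_iff_false]
      rw [this, measure_empty, Set.indicator_of_notMem (by simpa using hv)]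
  -- With zero shifts the Poisson parameter is 0, and since `0 ^ 0 = 1` only the component `l = 0`
  -- survives.
  have hlaw : γ.map (fun v => ∑ i, v i ^ 2) = gammaMeasure m 1 := by
    have h := map_sum_sq_pi_gaussianReal hm hcard (fun _ => 0)
    simp only [add_zero, noncentralGamma] at h
    rw [hγ, h]
    ext s hs
    rw [Measure.sum_apply _ hs, tsum_eq_single 0]
    · simp
    · intro l hl
      simp [hl]
  rw [hset, hmp.measure_preimage hAm.nullMeasurableSet, Measure.prod_apply hAm]
  simp_rw [hsec]
  rw [← lintegral_gammaMeasure_series hm hρ hx, ← lintegral_indicator measurableSet_Iic, ← hlaw,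
    lintegral_map _ (by fun_prop)]
  exact Measurable.indicator (by fun_prop) measurableSet_Iic

theorem measurable_maxChannel_pi (ρ : Fin M → ℝ) :
    Measurable fun z : Fin (M + 1) → Fin m ⊕ Fin m → ℝ =>
      maxChannel ρ (fun n k z => z n (Sum.inl k)) (fun n k z => z n (Sum.inr k)) z := by
  refine measurable_of_Iic fun x => ?_
  have : (fun z : Fin (M + 1) → Fin m ⊕ Fin m → ℝ =>
      maxChannel ρ (fun n k z => z n (Sum.inl k)) (fun n k z => z n (Sum.inr k)) z) ⁻¹' Set.Iic x =
      {z | ∑ k, z 0 (Sum.inl k) ^ 2 + ∑ k, z 0 (Sum.inr k) ^ 2 ≤ x} ∩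
        ⋂ n : Fin M, {z | ∑ k, (√(1 - ρ n ^ 2) * z n.succ (Sum.inl k) +
            ρ n * z 0 (Sum.inl k)) ^ 2 +
          ∑ k, (√(1 - ρ n ^ 2) * z n.succ (Sum.inr k) + ρ n * z 0 (Sum.inr k)) ^ 2 ≤ x} := by
    ext z
    simp [maxChannel_le_iff, channel_zero, channel_succ]
  rw [this]
  exact (measurableSet_le (by fun_prop) measurable_const).inter
    (MeasurableSet.iInter fun n => measurableSet_le (by fun_prop) measurable_const)

/-- The joint law of the components, grouped by ports. -/
theorem hasLaw_ports {Ω : Type*} [MeasurableSpace Ω] {P : Measure Ω} [IsProbabilityMeasure P]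
    {X Y : Fin (M + 1) → Fin m → Ω → ℝ}
    (hX : ∀ n k, HasLaw (X n k) (gaussianReal 0 (1 / 2)) P)
    (hY : ∀ n k, HasLaw (Y n k) (gaussianReal 0 (1 / 2)) P)
    (hindep : iIndepFun
      (Sum.elim (fun i : Fin (M + 1) × Fin m => X i.1 i.2)
        (fun i : Fin (M + 1) × Fin m => Y i.1 i.2)) P) :
    HasLaw (fun ω n => Sum.elim (fun k => X n k ω) (fun k => Y n k ω))
      (Measure.pi fun _ : Fin (M + 1) => Measure.pi fun _ : Fin m ⊕ Fin m =>
        gaussianReal 0 (1 / 2)) P := by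
  have h := hindep.precomp (Equiv.prodSumDistrib (Fin (M + 1)) (Fin m) (Fin m)).injective
  have hlaw : ∀ p : Fin (M + 1) × (Fin m ⊕ Fin m), HasLaw
      (Sum.elim (fun i : Fin (M + 1) × Fin m => X i.1 i.2)
        (fun i : Fin (M + 1) × Fin m => Y i.1 i.2) (Equiv.prodSumDistrib _ _ _ p))
      (gaussianReal 0 (1 / 2)) P := by
    rintro ⟨n, k | k⟩
    · exact hX n k
    · exact hY n k
  have hmap := h.map_fun_eq_pi_map fun p => (hlaw p).aemeasurable
  simp only [(hlaw _).map_eq] at hmap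
  -- Independence gives one product over pairs (port, component); currying makes it a product over
  -- ports of products.
  have hcurry := Measure.infinitePi_map_curry
    (fun (_ : Fin (M + 1)) (_ : Fin m ⊕ Fin m) => gaussianReal 0 (1 / 2))
  simp only [Measure.infinitePi_eq_pi] at hcurry
  have hf : (fun ω n => Sum.elim (fun k => X n k ω) (fun k => Y n k ω)) =
      MeasurableEquiv.curry (Fin (M + 1)) (Fin m ⊕ Fin m) ℝ ∘ fun ω p =>
        Sum.elim (fun i : Fin (M + 1) × Fin m => X i.1 i.2)
          (fun i : Fin (M + 1) × Fin m => Y i.1 i.2) (Equiv.prodSumDistrib _ _ _ p) ω := by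
    ext ω n (k | k) <;> rfl
  have hae : AEMeasurable (fun ω p =>
        Sum.elim (fun i : Fin (M + 1) × Fin m => X i.1 i.2)
          (fun i : Fin (M + 1) × Fin m => Y i.1 i.2) (Equiv.prodSumDistrib _ _ _ p) ω) P :=
    aemeasurable_pi_lambda _ fun p => (hlaw p).aemeasurable
  rw [hf]
  refine ⟨(MeasurableEquiv.measurable _).comp_aemeasurable hae, ?_⟩
  rw [← hcurry, ← hmap, AEMeasurable.map_map_of_aemeasurable
    (MeasurableEquiv.measurable _).aemeasurable hae]

theorem ofReal_cdf_maxChannel {Ω : Type*} [MeasurableSpace Ω] {P : Measure Ω}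
    [IsProbabilityMeasure P] (hm : 1 ≤ m) {ρ : Fin M → ℝ} (hρ : ∀ n, |ρ n| < 1)
    {X Y : Fin (M + 1) → Fin m → Ω → ℝ}
    (hX : ∀ n k, HasLaw (X n k) (gaussianReal 0 (1 / 2)) P)
    (hY : ∀ n k, HasLaw (Y n k) (gaussianReal 0 (1 / 2)) P)
    (hindep : iIndepFun
      (Sum.elim (fun i : Fin (M + 1) × Fin m => X i.1 i.2)
        (fun i : Fin (M + 1) × Fin m => Y i.1 i.2)) P)
    {x : ℝ} (hx : 0 ≤ x) :
    ENNReal.ofReal (cdf (P.map (maxChannel ρ X Y)) x) =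
      ∑' k : ℕ, ENNReal.ofReal (1 / Real.Gamma m *
        (coeff m ρ x k / S ρ ^ (m + k) * lowerGamma (m + k) (S ρ * x))) := by
  have hlaw := hasLaw_ports hX hY hindep
  have hF := measurable_maxChannel_pi (m := m) ρ
  have hcomp : maxChannel ρ X Y = (fun z : Fin (M + 1) → Fin m ⊕ Fin m → ℝ =>
      maxChannel ρ (fun n k z => z n (Sum.inl k)) (fun n k z => z n (Sum.inr k)) z) ∘
        fun ω n => Sum.elim (fun k => X n k ω) (fun k => Y n k ω) := rfl
  have := Measure.isProbabilityMeasure_map (μ := P) (f := maxChannel ρ X Y)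
    (hcomp ▸ hF.comp_aemeasurable hlaw.aemeasurable)
  rw [cdf_eq_real, ofReal_measureReal, hcomp,
    ← AEMeasurable.map_map_of_aemeasurable hF.aemeasurable hlaw.aemeasurable, hlaw.map_eq,
    Measure.map_apply hF measurableSet_Iic]
  exact pi_gaussianReal_maxChannel_le hm hρ hx

theorem S_eq_one {ρ : Fin M → ℝ} (h : ∀ n, ρ n = 0) : S ρ = 1 := by
  simp [S, h]

theorem coeff_eq_zero {ρ : Fin M → ℝ} (h : ∀ n, ρ n = 0) (x : ℝ) {k : ℕ} (hk : 0 < k) :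
    coeff m ρ x k = 0 := by
  refine Finset.sum_eq_zero fun l hl => ?_
  obtain ⟨n, hn⟩ : ∃ n, l n ≠ 0 := by
    by_contra! h0
    have := (Finset.mem_piAntidiag.1 hl).1
    simp [h0] at this
    omega
  exact Finset.prod_eq_zero (Finset.mem_univ n) (by simp [alpha, h, hn])

theorem coeff_zero {ρ : Fin M → ℝ} (h : ∀ n, ρ n = 0) (x : ℝ) :
    coeff m ρ x 0 = (1 / Real.Gamma m * lowerGamma m x) ^ M := by
  simp [coeff, alpha, h]
  ring

end Model

end FluidAntenna

end

theorem proposition1 {Ω : Type*} [MeasurableSpace Ω] (P : Measure Ω) [IsProbabilityMeasure P]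
    (M m : ℕ) (hm : 1 ≤ m)
    (ρ : Fin M → ℝ) (hρ : ∀ n, |ρ n| < 1)
    (X Y : Fin (M + 1) → Fin m → Ω → ℝ)
    (hX : ∀ n k, HasLaw (X n k) (gaussianReal 0 (1 / 2)) P)
    (hY : ∀ n k, HasLaw (Y n k) (gaussianReal 0 (1 / 2)) P)
    (hindep : iIndepFun
      (Sum.elim (fun i : Fin (M + 1) × Fin m => X i.1 i.2)
        (fun i : Fin (M + 1) × Fin m => Y i.1 i.2)) P)
    (x : ℝ) (hx : 0 ≤ x) :
    (Summable (fun k : ℕ =>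
        FluidAntenna.coeff m ρ x k / FluidAntenna.S ρ ^ (m + k) *
          FluidAntenna.lowerGamma (m + k) (FluidAntenna.S ρ * x)) ∧
      cdf (P.map (FluidAntenna.maxChannel ρ X Y)) x =
        1 / Real.Gamma m * ∑' k : ℕ,
          FluidAntenna.coeff m ρ x k / FluidAntenna.S ρ ^ (m + k) *
            FluidAntenna.lowerGamma (m + k) (FluidAntenna.S ρ * x)) ∧
    ((∀ n, ρ n = 0) →
      FluidAntenna.S ρ = 1 ∧
      (∀ k : ℕ, 0 < k → FluidAntenna.coeff m ρ x k = 0) ∧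
      cdf (P.map (FluidAntenna.maxChannel ρ X Y)) x =
        (1 / Real.Gamma m * FluidAntenna.lowerGamma m x) ^ (M + 1)) := by
  have hG : 0 < Real.Gamma m := Real.Gamma_pos_of_pos (by exact_mod_cast hm)
  have hS := FluidAntenna.S_pos hρ
  have hcdf := FluidAntenna.ofReal_cdf_maxChannel hm hρ hX hY hindep hx
  have hnonneg : ∀ k : ℕ, 0 ≤ 1 / Real.Gamma m *
      (FluidAntenna.coeff m ρ x k / FluidAntenna.S ρ ^ (m + k) *
        FluidAntenna.lowerGamma (m + k) (FluidAntenna.S ρ * x)) := fun k => by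
    have := FluidAntenna.coeff_nonneg hm hρ hx k
    have := FluidAntenna.lowerGamma_nonneg (m + k) (mul_nonneg hS.le hx)
    positivity
  -- The `ENNReal` sum equals a finite value of the distribution function, which yields real
  -- summability.
  have hsum := ENNReal.summable_toReal (hcdf ▸ ENNReal.ofReal_ne_top)
  simp only [ENNReal.toReal_ofReal (hnonneg _)] at hsum
  rw [← ENNReal.ofReal_tsum_of_nonneg hnonneg hsum,
    ENNReal.ofReal_eq_ofReal_iff (cdf_nonneg _ _) (tsum_nonneg hnonneg), tsum_mul_left] at hcdf
  refine ⟨⟨(summable_mul_left_iff (by positivity)).1 hsum, hcdf⟩, fun h => ?_⟩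
  have h1 := FluidAntenna.S_eq_one h
  refine ⟨h1, fun k hk => FluidAntenna.coeff_eq_zero h x hk, ?_⟩
  rw [hcdf, tsum_eq_single 0 fun k hk => by
    simp [FluidAntenna.coeff_eq_zero h x (Nat.pos_of_ne_zero hk)]]
  -- The `k = 0` term carries `M` factors from `coeff` and one more from the reference port.
  rw [FluidAntenna.coeff_zero h, h1]
  simp
  ring
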